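/- A commutative semi-ring of characteristic $1$ is a triple $(\mathcal R,\oplus,+)$ where $(\mathcal R,+)$ is a commutative monoid with neutral element $0$, $\oplus$ is an associative, commutative and idempotent law on $\mathcal R$ (no neutral element for $\oplus$ is required), and $X+(Y\oplus Z)=(X+Y)\oplus(X+Z)$ for all $X,Y,Z$. It is ordered by $X\le Y\iff X\oplus Y=Y$. It is cancellative if $X+Y=X+Z$ implies $Y=Z$, and perfect if for every integer $n\ge 1$ the map $\theta_n:X\mapsto nX$ is surjective. If it is cancellative and perfect, the maps $\theta_n$ are bijective, and $\mathbb Q^{+}=\mathbb Q\cap[0,\infty)$ acts on $\mathcal R$ by $\frac ab X=\theta_a(\theta_b^{-1}(X))$ for integers $a\ge 0$, $b\ge 1$. Let $(\mathcal R,\oplus,+)$ be a cancellative perfect commutative semi-ring of characteristic $1$, and let $E\in\mathcal R$. For $X,Y\in\mathcal R$ and $t\in\mathbb Q^+$ the inequalities $-tE\le X-Y\le tE$ are those of the semi-field of fractions of $\mathcal R$, that is, $Y\le X+tE$ and $X\le Y+tE$ in $\mathcal R$. Put $r(X-Y)=\inf\{t\in\mathbb Q^+ : -tE\le X-Y\le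 tE\}$. Suppose that $\mathcal R$ is Banach with respect to $E$: every $X\in\mathcal R$ satisfies $-tE\le X\le tE$ for some $t\in\mathbb Q^+$; $r(X-Y)=0$ implies $X=Y$; and $\mathcal R$ is complete for the distance $(X,Y)\mapsto r(X-Y)$. Then the action of $\mathbb Q^{+}$ extends by continuity to an action of $\mathbb R^+=[0,\infty)$ on $\mathcal R$: $\lambda X=\lim_n t_nX$ for any sequence $(t_n)$ in $\mathbb Q^+$ converging to $\lambda$. A congruence on $\mathcal R$ is an equivalence relation $\sim$ such that $X\sim Y$ implies $X+Z\sim Y+Z$ and $X\oplus Z\sim Y\oplus Z$. It is cancellative if $X+Y\sim X+Z$ implies $Y\sim Z$, and trivial if it has only one class. A maximal cancellative congruence is a non-trivial cancellative congruence $\sim$ such that every cancellative congruence containing $\sim$ is equal to $\sim$ or trivial. **Theorem.** Let $\sim$ be a maximal cancellative congruence on $\mathcal R$, and let $\pi_0:\mathcal R\to\mathcal R/\!\sim$ be the projection onto the quotient semi-ring. Then the action of $\mathbb R^+$ descends to $\mathcal R/\!\sim$ by $\lambda\,\pi_0(X)=\pi_0(\lambda X)$, and: 1. If every $X_1\in\mathcal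 R/\!\sim$ satisfies $0\le X_1$, then $\mathcal R/\!\sim\;=\{\lambda\pi_0(E) : \lambda\in\mathbb R^+\}$, and $\lambda\pi_0(E)\mapsto\lambda$ is a (well defined) isomorphism of semi-rings $(\mathcal R/\!\sim,\oplus,+)\to(\mathbb R^+,\max,+)$. 2. If some $X_1\in\mathcal R/\!\sim$ does not satisfy $0\le X_1$, then there is an isomorphism of semi-rings $(\mathcal R/\!\sim,\oplus,+)\to(\mathbb R,\max,+)$. -/

import Mathlib

open Filter Topology
open scoped NNReal

namespace CharOne

/-- A commutative semi-ring `(R, ⊕, +)` of characteristic one. The idempotent, commutative and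
associative law `⊕` is written `⊔`; the canonical order is `X ≤ Y ↔ X ⊔ Y = Y`, as in every
`SemilatticeSup`. No neutral element for `⊔` is required. -/
class CharOneSemiring (R : Type*) extends AddCommMonoid R, SemilatticeSup R where
  add_sup_distrib : ∀ X Y Z : R, X + (Y ⊔ Z) = (X + Y) ⊔ (X + Z)

/-- `(ℝ, max, +)`. -/
noncomputable instance : CharOneSemiring ℝ where
  add_sup_distrib X Y Z := (max_add_add_left X Y Z).symm

/-- `(ℝ⁺, max, +)`, with `ℝ⁺ = [0, ∞)`. -/
noncomputable instance : CharOneSemiring ℝ≥0 where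
  add_sup_distrib X Y Z := (max_add_add_left X Y Z).symm

/-- Isomorphisms of semi-rings of characteristic one. -/
structure SemiringIso (A B : Type*) [CharOneSemiring A] [CharOneSemiring B] extends A ≃ B where
  map_sup : ∀ X Y : A, toFun (X ⊔ Y) = toFun X ⊔ toFun Y
  map_add : ∀ X Y : A, toFun (X + Y) = toFun X + toFun Y

/-- Perfect: multiplication by each integer `n ≥ 1` is surjective. -/
class IsPerfect (R : Type*) [CharOneSemiring R] : Prop where
  nsmul_surjective : ∀ n : ℕ, 0 < n → Function.Surjective (fun X : R => n • X)

section Rational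

variable {R : Type*} [CharOneSemiring R]

theorem add_mono {X Y : R} (h : X ≤ Y) (Z : R) : Z + X ≤ Z + Y := by
  rw [← sup_eq_right] at h ⊢
  rw [← CharOneSemiring.add_sup_distrib, h]

theorem add_mono₂ {X Y Z W : R} (h : X ≤ Y) (h' : Z ≤ W) : X + Z ≤ Y + W :=
  (add_mono h' X).trans (by rw [add_comm X W, add_comm Y W]; exact add_mono h W)

theorem nsmul_mono {X Y : R} (h : X ≤ Y) (n : ℕ) : n • X ≤ n • Y := by
  induction n with
  | zero => simp
  | succ n ih => rw [succ_nsmul, succ_nsmul]; exact add_mono₂ ih h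

theorem nsmul_sup_le (X Y W : R) (m : ℕ) : ∀ C : R,
    (∀ a b : ℕ, a + b = m → C + (a • X + b • Y) ≤ W) → C + m • (X ⊔ Y) ≤ W := by
  induction m with
  | zero => intro C h; simpa using h 0 0 rfl
  | succ m ih =>
    intro C h
    have e : C + (m + 1) • (X ⊔ Y) = (C + X + m • (X ⊔ Y)) ⊔ (C + Y + m • (X ⊔ Y)) := by
      rw [succ_nsmul, ← add_assoc, CharOneSemiring.add_sup_distrib]
      congr 1 <;> abel
    rw [e]
    refine sup_le (ih _ fun a b hab => ?_) (ih _ fun a b hab => ?_)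
    · have := h (a + 1) b (by omega)
      rw [succ_nsmul] at this
      convert this using 1; abel
    · have := h a (b + 1) (by omega)
      rw [succ_nsmul] at this
      convert this using 1; abel

variable [IsCancelAdd R]

theorem le_of_add_le {X Y Z : R} (h : Z + X ≤ Z + Y) : X ≤ Y := by
  rw [← sup_eq_right] at h ⊢
  rw [← CharOneSemiring.add_sup_distrib] at h
  exact add_left_cancel h

theorem le_of_nsmul_le {n : ℕ} (hn : 0 < n) {X Y : R} (h : n • X ≤ n • Y) : X ≤ Y := by
  obtain ⟨k, rfl⟩ : ∃ k, n = k + 1 := ⟨n - 1, by omega⟩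
  set Z := X ⊔ Y with hZ
  have hX : X ≤ Z := le_sup_left
  have hY : Y ≤ Z := le_sup_right
  have key : (0 : R) + (k + (k + 1)) • Z ≤ k • Z + (k + 1) • Y := by
    refine nsmul_sup_le X Y _ _ 0 fun a b hab => ?_
    rw [zero_add]
    have hm : ∀ p q : ℕ, p + q = k → p • X + q • Y ≤ k • Z := fun p q hpq => by
      rw [← hpq, add_nsmul]; exact add_mono₂ (nsmul_mono hX _) (nsmul_mono hY _)
    rcases le_or_gt (k + 1) a with ha | ha
    · obtain ⟨c, rfl⟩ := Nat.exists_eq_add_of_le ha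
      have : (k + 1 + c) • X + b • Y = (c • X + b • Y) + (k + 1) • X := by
        rw [add_nsmul]; abel
      rw [this]
      exact add_mono₂ (hm _ _ (by omega)) h
    · obtain ⟨c, rfl⟩ : ∃ c, b = k + 1 + c := ⟨b - (k + 1), by omega⟩
      have : a • X + (k + 1 + c) • Y = (a • X + c • Y) + (k + 1) • Y := by
        rw [add_nsmul]; abel
      rw [this]
      exact add_mono₂ (hm _ _ (by omega)) le_rfl
  rw [zero_add, add_nsmul] at key
  have k2 := le_of_add_le key
  have k3 : k • Y + Z ≤ k • Y + Y := by
    refine le_trans ?_ (k2.trans (by rw [succ_nsmul]))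
    rw [succ_nsmul]
    exact add_mono₂ (nsmul_mono hY _) le_rfl
  exact hX.trans (le_of_add_le k3)

theorem nsmul_injective {n : ℕ} (hn : 0 < n) {X Y : R} (h : n • X = n • Y) : X = Y :=
  le_antisymm (le_of_nsmul_le hn h.le) (le_of_nsmul_le hn h.ge)

end Rational

section RationalAction

variable {R : Type*} [CharOneSemiring R] [IsPerfect R]

/-- The action of the non-negative rationals, `(a / b) X = θ_a (θ_b⁻¹ X)`, where `θ_n X = n X`
(for cancellative `R` the map `θ_b` is bijective, see `nsmul_injective`). -/
noncomputable def qsmul (t : ℚ≥0) (X : R) : R :=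
  t.num • (IsPerfect.nsmul_surjective (R := R) t.den t.den_pos X).choose

theorem den_nsmul_qsmul (t : ℚ≥0) (X : R) : t.den • qsmul t X = t.num • X := by
  have h := (IsPerfect.nsmul_surjective (R := R) t.den t.den_pos X).choose_spec
  rw [qsmul, smul_comm]
  exact congrArg _ h

theorem qsmul_zero_left (X : R) : qsmul 0 X = 0 := by simp [qsmul]

variable [IsCancelAdd R]

/-- Independence of the representative of the fraction. -/
theorem nsmul_qsmul {t : ℚ≥0} {a b : ℕ} (h : (b : ℚ≥0) * t = a) (X : R) :
    b • qsmul t X = a • X := by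
  have h2 : b * t.num = a * t.den := by
    have h1 : (t.den : ℚ≥0) * t = t.num := by
      rw [mul_comm]; exact NNRat.mul_den_eq_num t
    have : ((b * t.num : ℕ) : ℚ≥0) = (a * t.den : ℕ) := by
      push_cast
      rw [← h1, ← h]; ring
    exact_mod_cast this
  apply nsmul_injective t.den_pos
  rw [smul_comm, den_nsmul_qsmul, ← mul_smul, ← mul_smul, h2, mul_comm]

theorem eq_qsmul {t : ℚ≥0} {a b : ℕ} (hb : 0 < b) (h : (b : ℚ≥0) * t = a) {X Y : R}
    (hY : b • Y = a • X) : Y = qsmul t X :=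
  nsmul_injective hb (hY.trans (nsmul_qsmul h X).symm)

theorem den_mul (t : ℚ≥0) : (t.den : ℚ≥0) * t = t.num := by
  rw [mul_comm]; exact NNRat.mul_den_eq_num t

theorem qsmul_one (X : R) : qsmul 1 X = X :=
  (eq_qsmul (a := 1) (b := 1) one_pos (by simp) rfl).symm

theorem qsmul_add_left (s t : ℚ≥0) (X : R) : qsmul (s + t) X = qsmul s X + qsmul t X := by
  refine (eq_qsmul (a := s.num * t.den + t.num * s.den) (b := s.den * t.den)
    (Nat.mul_pos s.den_pos t.den_pos) ?_ ?_).symm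
  · push_cast
    rw [← den_mul s, ← den_mul t]; ring
  · rw [nsmul_add, add_nsmul]
    congr 1
    · rw [mul_comm, mul_smul, den_nsmul_qsmul, ← mul_smul, mul_comm]
    · rw [mul_smul, den_nsmul_qsmul, ← mul_smul, mul_comm]

theorem qsmul_add_right (t : ℚ≥0) (X Y : R) : qsmul t (X + Y) = qsmul t X + qsmul t Y := by
  refine (eq_qsmul t.den_pos (den_mul t) ?_).symm
  rw [nsmul_add, den_nsmul_qsmul, den_nsmul_qsmul, nsmul_add]

theorem qsmul_zero_right (t : ℚ≥0) : qsmul t (0 : R) = 0 :=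
  (eq_qsmul t.den_pos (den_mul t) (by simp)).symm

theorem qsmul_qsmul (s t : ℚ≥0) (X : R) : qsmul s (qsmul t X) = qsmul (s * t) X := by
  refine eq_qsmul (a := s.num * t.num) (b := s.den * t.den)
    (Nat.mul_pos s.den_pos t.den_pos) ?_ ?_
  · push_cast
    rw [← den_mul s, ← den_mul t]; ring
  · rw [mul_comm, mul_smul, den_nsmul_qsmul, smul_comm, den_nsmul_qsmul, ← mul_smul]

theorem qsmul_mono (t : ℚ≥0) {X Y : R} (h : X ≤ Y) : qsmul t X ≤ qsmul t Y := by
  apply le_of_nsmul_le t.den_pos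
  rw [den_nsmul_qsmul, den_nsmul_qsmul]
  exact nsmul_mono h _

end RationalAction

section Banach

variable {R : Type*} [CharOneSemiring R] [IsPerfect R]

/-- The inequalities `-tE ≤ X - Y ≤ tE` of the semi-field of fractions `{A - B | A, B ∈ R}`. Its
order is `A - B ≤ C - D ↔ A + D ≤ C + B`, so they read `Y ≤ X + tE` and `X ≤ Y + tE` in `R`. -/
def Within (E : R) (t : ℚ≥0) (X Y : R) : Prop :=
  Y ≤ X + qsmul t E ∧ X ≤ Y + qsmul t E

/-- `r(X - Y) = inf {t ∈ ℚ⁺ | -tE ≤ X - Y ≤ tE}`. -/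
noncomputable def rdist (E X Y : R) : ℝ :=
  sInf {x : ℝ | ∃ t : ℚ≥0, x = (t : ℝ) ∧ Within E t X Y}

/-- `R` is a Banach semi-ring with respect to the absorbing element `E`. -/
structure IsBanach (E : R) : Prop where
  /-- every `X` satisfies `-tE ≤ X ≤ tE` for some `t ∈ ℚ⁺` -/
  absorbing : ∀ X : R, ∃ t : ℚ≥0, Within E t X 0
  /-- `r(X - Y)` separates points -/
  separated : ∀ X Y : R, rdist E X Y = 0 → X = Y
  /-- every Cauchy sequence for the distance `r(X - Y)` converges in `R` -/
  complete : ∀ u : ℕ → R,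
    (∀ ε : ℝ, 0 < ε → ∃ N : ℕ, ∀ m n : ℕ, N ≤ m → N ≤ n → rdist E (u m) (u n) < ε) →
    ∃ X : R, Tendsto (fun n => rdist E (u n) X) atTop (𝓝 0)

/-- `Y` is the real multiple `lam X`: it is the limit of `t_n X` whenever the non-negative
rationals `t_n` tend to `lam`. -/
def IsRealMultiple (E : R) (lam : ℝ≥0) (X Y : R) : Prop :=
  ∀ t : ℕ → ℚ≥0, Tendsto (fun n => ((t n : ℚ≥0) : ℝ)) atTop (𝓝 (lam : ℝ)) →
    Tendsto (fun n => rdist E (qsmul (t n) X) Y) atTop (𝓝 0)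

theorem rdist_nonneg (E X Y : R) : 0 ≤ rdist E X Y := by
  apply Real.sInf_nonneg
  rintro _ ⟨t, rfl, -⟩
  positivity

theorem rdist_le {E X Y : R} {t : ℚ≥0} (h : Within E t X Y) : rdist E X Y ≤ t :=
  csInf_le ⟨0, by rintro _ ⟨s, rfl, -⟩; positivity⟩ (by exact ⟨t, rfl, h⟩)

theorem Within.symm {E X Y : R} {t : ℚ≥0} (h : Within E t X Y) : Within E t Y X := ⟨h.2, h.1⟩

theorem rdist_comm (E X Y : R) : rdist E X Y = rdist E Y X := by
  unfold rdist
  congr 1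
  ext x
  exact ⟨fun ⟨t, h, w⟩ => ⟨t, h, w.symm⟩, fun ⟨t, h, w⟩ => ⟨t, h, w.symm⟩⟩

variable [IsCancelAdd R]

theorem Within.trans {E X Y Z : R} {s t : ℚ≥0} (h : Within E s X Y) (h' : Within E t Y Z) :
    Within E (s + t) X Z := by
  unfold Within
  rw [qsmul_add_left]
  constructor
  · calc Z ≤ Y + qsmul t E := h'.1
      _ ≤ X + qsmul s E + qsmul t E := add_mono₂ h.1 le_rfl
      _ = _ := by abel
  · calc X ≤ Y + qsmul s E := h.2
      _ ≤ Z + qsmul t E + qsmul s E := add_mono₂ h'.2 le_rfl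
      _ = _ := by abel

theorem IsBanach.exists_within {E : R} (hE : IsBanach E) (X Y : R) :
    ∃ t : ℚ≥0, Within E t X Y := by
  obtain ⟨s, hs⟩ := hE.absorbing X
  obtain ⟨t, ht⟩ := hE.absorbing Y
  exact ⟨s + t, hs.trans ht.symm⟩

theorem IsBanach.exists_within_lt {E : R} (hE : IsBanach E) {X Y : R} {ε : ℝ}
    (h : rdist E X Y < ε) : ∃ t : ℚ≥0, (t : ℝ) < ε ∧ Within E t X Y := by
  obtain ⟨t, ht⟩ := hE.exists_within X Y
  obtain ⟨x, ⟨s, rfl, hs⟩, hx⟩ := exists_lt_of_csInf_lt (by exact ⟨_, t, rfl, ht⟩) h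
  exact ⟨s, hx, hs⟩

theorem IsBanach.rdist_triangle {E : R} (hE : IsBanach E) (X Y Z : R) :
    rdist E X Z ≤ rdist E X Y + rdist E Y Z := by
  refine le_of_forall_pos_le_add fun ε hε => ?_
  obtain ⟨s, hs, ws⟩ := hE.exists_within_lt (lt_add_of_pos_right (rdist E X Y) (half_pos hε))
  obtain ⟨t, ht, wt⟩ := hE.exists_within_lt (lt_add_of_pos_right (rdist E Y Z) (half_pos hε))
  have := rdist_le (ws.trans wt)
  push_cast at this
  linarith

theorem within_qsmul {E X : R} {t : ℚ≥0} (h : Within E t X 0) (p d : ℚ≥0) :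
    Within E (d * t) (qsmul p X) (qsmul (p + d) X) := by
  have h1 : (0 : R) ≤ qsmul d X + qsmul (d * t) E := by
    have := qsmul_mono d h.1
    rwa [qsmul_zero_right, qsmul_add_right, qsmul_qsmul] at this
  have h2 : qsmul d X ≤ qsmul (d * t) E := by
    have := qsmul_mono d h.2
    rwa [zero_add, qsmul_qsmul] at this
  unfold Within
  rw [qsmul_add_left]
  refine ⟨add_mono h2 _, ?_⟩
  have := add_mono h1 (qsmul p X)
  rwa [add_zero, ← add_assoc] at this

theorem rdist_qsmul_le {E X : R} {t : ℚ≥0} (h : Within E t X 0) (p q : ℚ≥0) :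
    rdist E (qsmul p X) (qsmul q X) ≤ |(p : ℝ) - q| * t := by
  rcases le_total p q with hpq | hpq
  · obtain ⟨d, rfl⟩ := exists_add_of_le hpq
    have := rdist_le (within_qsmul h p d)
    push_cast at this ⊢
    rwa [sub_add_cancel_left, abs_neg, abs_of_nonneg (by positivity)]
  · obtain ⟨d, rfl⟩ := exists_add_of_le hpq
    have := rdist_le (within_qsmul h q d)
    rw [rdist_comm]
    push_cast at this ⊢
    rwa [add_sub_cancel_left, abs_of_nonneg (by positivity)]

theorem exists_tendsto_nnrat (lam : ℝ≥0) :
    ∃ t : ℕ → ℚ≥0, Tendsto (fun n => ((t n : ℚ≥0) : ℝ)) atTop (𝓝 (lam : ℝ)) := by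
  refine ⟨fun n => (⌊(lam : ℝ) * n⌋₊ : ℚ≥0) / n, ?_⟩
  have := (tendsto_nat_floor_mul_div_atTop (R := ℝ) lam.2).comp tendsto_natCast_atTop_atTop
  simpa [Function.comp_def] using this

/-- Real multiples exist and are unique in a Banach semi-ring. -/
theorem IsBanach.existsUnique_isRealMultiple {E : R} (hE : IsBanach E) (lam : ℝ≥0) (X : R) :
    ∃! Y : R, IsRealMultiple E lam X Y := by
  obtain ⟨s, hs⟩ := hE.absorbing X
  obtain ⟨t₀, ht₀⟩ := exists_tendsto_nnrat lam
  have hcau : ∀ ε : ℝ, 0 < ε → ∃ N : ℕ, ∀ m n : ℕ, N ≤ m → N ≤ n →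
      rdist E (qsmul (t₀ m) X) (qsmul (t₀ n) X) < ε := by
    intro ε hε
    have hs0 : (0 : ℝ) < s + 1 := by positivity
    obtain ⟨N, hN⟩ := Metric.cauchySeq_iff.1 ht₀.cauchySeq (ε / (s + 1)) (by positivity)
    refine ⟨N, fun m n hm hn => (rdist_qsmul_le hs _ _).trans_lt ?_⟩
    have h1 := hN m hm n hn
    rw [Real.dist_eq, lt_div_iff₀ hs0] at h1
    have h2 := abs_nonneg (((t₀ m : ℚ≥0) : ℝ) - t₀ n)
    linarith
  obtain ⟨Y, hY⟩ := hE.complete _ hcau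
  refine ⟨Y, ?_, ?_⟩
  · intro t ht
    have h1 : Tendsto (fun n => |((t n : ℚ≥0) : ℝ) - t₀ n| * s
        + rdist E (qsmul (t₀ n) X) Y) atTop (𝓝 0) := by
      have := ((ht.sub ht₀).abs.mul_const (s : ℝ)).add hY
      simpa using this
    refine squeeze_zero (fun n => rdist_nonneg _ _ _) (fun n => ?_) h1
    have h2 := hE.rdist_triangle (qsmul (t n) X) (qsmul (t₀ n) X) Y
    have h3 := rdist_qsmul_le hs (t n) (t₀ n)
    linarith
  · intro Z hZ
    apply hE.separated
    refine le_antisymm ?_ (rdist_nonneg _ _ _)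
    have h1 := (hZ t₀ ht₀).add hY
    rw [add_zero] at h1
    refine ge_of_tendsto' h1 fun n => ?_
    have h2 := hE.rdist_triangle Z (qsmul (t₀ n) X) Y
    rwa [rdist_comm E Z (qsmul (t₀ n) X)] at h2

/-- The action of `ℝ⁺` on a Banach semi-ring, extending that of `ℚ⁺` by continuity. -/
noncomputable def realMul {E : R} (hE : IsBanach E) (lam : ℝ≥0) (X : R) : R :=
  (hE.existsUnique_isRealMultiple lam X).choose

theorem isRealMultiple_realMul {E : R} (hE : IsBanach E) (lam : ℝ≥0) (X : R) :
    IsRealMultiple E lam X (realMul hE lam X) :=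
  (hE.existsUnique_isRealMultiple lam X).choose_spec.1

end Banach

/-- A congruence on a semi-ring of characteristic one. -/
structure Congruence (R : Type*) [CharOneSemiring R] extends Setoid R where
  add_right : ∀ X Y Z : R, r X Y → r (X + Z) (Y + Z)
  sup_right : ∀ X Y Z : R, r X Y → r (X ⊔ Z) (Y ⊔ Z)

namespace Congruence

variable {R : Type*} [CharOneSemiring R]

/-- `c` is cancellative. -/
def Cancellative (c : Congruence R) : Prop :=
  ∀ X Y Z : R, c.r (X + Y) (X + Z) → c.r Y Z

/-- The trivial congruence has only one class. -/
def Trivial (c : Congruence R) : Prop := ∀ X Y : R, c.r X Y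

/-- Maximal elements among the non-trivial cancellative congruences. -/
def IsMaximalCancellative (c : Congruence R) : Prop :=
  c.Cancellative ∧ ¬ c.Trivial ∧
    ∀ d : Congruence R, d.Cancellative → (∀ X Y : R, c.r X Y → d.r X Y) →
      (∀ X Y : R, d.r X Y ↔ c.r X Y) ∨ d.Trivial

/-- The quotient semi-ring `R / c`. -/
def Quot (c : Congruence R) : Type _ := Quotient c.toSetoid

/-- The projection `R → R / c`. -/
def proj (c : Congruence R) (X : R) : c.Quot := Quotient.mk c.toSetoid X

theorem add_congr (c : Congruence R) {X X' Y Y' : R} (h : c.r X X') (h' : c.r Y Y') :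
    c.r (X + Y) (X' + Y') := by
  refine c.iseqv.trans (c.add_right _ _ Y h) ?_
  rw [add_comm X', add_comm X']
  exact c.add_right _ _ X' h'

theorem sup_congr (c : Congruence R) {X X' Y Y' : R} (h : c.r X X') (h' : c.r Y Y') :
    c.r (X ⊔ Y) (X' ⊔ Y') := by
  refine c.iseqv.trans (c.sup_right _ _ Y h) ?_
  rw [sup_comm X', sup_comm X']
  exact c.sup_right _ _ X' h'

instance (c : Congruence R) : Add c.Quot :=
  ⟨Quotient.map₂ (· + ·) fun _ _ h _ _ h' => c.add_congr h h'⟩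

instance (c : Congruence R) : Max c.Quot :=
  ⟨Quotient.map₂ (· ⊔ ·) fun _ _ h _ _ h' => c.sup_congr h h'⟩

instance (c : Congruence R) : Zero c.Quot := ⟨c.proj 0⟩

theorem proj_surjective (c : Congruence R) : Function.Surjective c.proj := Quotient.exists_rep

theorem proj_add (c : Congruence R) (X Y : R) : c.proj (X + Y) = c.proj X + c.proj Y := rfl

theorem max_proj (c : Congruence R) (X Y : R) : c.proj (X ⊔ Y) = max (c.proj X) (c.proj Y) := rfl

theorem proj_zero (c : Congruence R) : c.proj 0 = 0 := rfl

theorem proj_eq_iff (c : Congruence R) {X Y : R} : c.proj X = c.proj Y ↔ c.r X Y := Quotient.eq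

instance (c : Congruence R) : AddCommMonoid c.Quot where
  add_assoc := c.proj_surjective.forall₃.2 fun X Y Z => by
    rw [← proj_add, ← proj_add, ← proj_add, ← proj_add, add_assoc]
  zero_add := c.proj_surjective.forall.2 fun X => by
    rw [← proj_zero, ← proj_add, zero_add]
  add_zero := c.proj_surjective.forall.2 fun X => by
    rw [← proj_zero, ← proj_add, add_zero]
  add_comm := c.proj_surjective.forall₂.2 fun X Y => by
    rw [← proj_add, ← proj_add, add_comm]
  nsmul := nsmulRec

instance (c : Congruence R) : SemilatticeSup c.Quot :=
  SemilatticeSup.mk'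
    (c.proj_surjective.forall₂.2 fun X Y => by rw [← max_proj, ← max_proj, sup_comm])
    (c.proj_surjective.forall₃.2 fun X Y Z => by
      rw [← max_proj, ← max_proj, ← max_proj, ← max_proj, sup_assoc])
    (c.proj_surjective.forall.2 fun X => by rw [← max_proj, sup_idem])

theorem proj_sup (c : Congruence R) (X Y : R) : c.proj (X ⊔ Y) = c.proj X ⊔ c.proj Y := rfl

/-- The laws of `R / c` are those induced by `R`. -/
instance (c : Congruence R) : CharOneSemiring c.Quot where
  add_sup_distrib := c.proj_surjective.forall₃.2 fun X Y Z =>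
    congrArg c.proj (CharOneSemiring.add_sup_distrib X Y Z)

end Congruence

end CharOne

/-! By maximality, the only cancellative congruences on the quotient `S` are equality and the
trivial one. Simplicity makes `S` totally ordered: if `A` and `B` were incomparable, put `M = A ⊔
B`; the congruences generated by `A ~ M` and by `B ~ M` would both be trivial, so `E` would lie
below multiples of both `M - A` and `M - B`. These differences are disjoint, which forces `E ≤ 0`
(`nonpos_of_add_nsmul_le`).

In a totally ordered semi-ring with absorbing `E > 0`, measuring elements against rational multiples
of `E` gives a morphism `F` to `(ℝ, max, +)` with `F E = 1` (`exists_state`). Its kernel is a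
non-trivial cancellative congruence, so simplicity also makes `F` injective.

Completeness serves only to provide the real multiples of elements of `R`. Composed with the
projection, `F` is a contraction, so it commutes with these multiples and its image contains `[0,
∞)`; a single negative value then makes the image all of `ℝ`. -/

namespace CharOne

/-! ### Rational multiples and strict positivity of `E` -/

section RationalMultiples

variable {S : Type*} [CharOneSemiring S] [IsPerfect S]

/-- Additive maps to `ℝ` commute with rational multiples. -/
theorem map_qsmul_real (f : S →+ ℝ) (t : ℚ≥0) (X : S) : f (qsmul t X) = t * f X := by
  have h := congrArg f (den_nsmul_qsmul t X)
  rw [map_nsmul, map_nsmul, nsmul_eq_mul, nsmul_eq_mul] at h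
  have hd : (t.den : ℝ) ≠ 0 := by exact_mod_cast t.den_ne_zero
  have hn : (t.den : ℝ) * (t : ℝ) = t.num := by exact_mod_cast den_mul t
  apply mul_left_cancel₀ hd
  rw [h, ← hn, mul_assoc]

variable [IsCancelAdd S]

theorem le_of_qsmul_le_qsmul {E : S} (hE : 0 ≤ E) (hE' : E ≠ 0) {p q : ℚ≥0}
    (h : qsmul p E ≤ qsmul q E) : p ≤ q := by
  by_contra! hlt
  obtain ⟨d, rfl⟩ := exists_add_of_le hlt.le
  have hd : d ≠ 0 := by rintro rfl; simp at hlt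
  rw [qsmul_add_left] at h
  have h1 : qsmul d E ≤ 0 := le_of_add_le (Z := qsmul q E) (by rwa [add_zero])
  have h2 := nsmul_mono h1 d.den
  rw [den_nsmul_qsmul, smul_zero] at h2
  have h3 : 0 < d.num := Nat.pos_of_ne_zero (by simpa using hd)
  exact hE' (le_antisymm (le_of_nsmul_le h3 (by rwa [smul_zero])) hE)

end RationalMultiples

/-! ### The real-valued gauge of a totally ordered semi-ring -/

section State

variable {S : Type*} [CharOneSemiring S] [IsPerfect S]

/-- The upper cut of `X` measured in units of `E`. -/
def upperCut (E X : S) : Set ℝ :=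
  {x | ∃ p q : ℚ≥0, x = (p : ℝ) - q ∧ X + qsmul q E ≤ qsmul p E}

/-- The size of `X` in units of `E`. -/
noncomputable def gauge (E X : S) : ℝ := sInf (upperCut E X)

theorem upperCut_nonempty {E X : S} (hX : ∃ t : ℚ≥0, Within E t X 0) :
    (upperCut E X).Nonempty := by
  obtain ⟨t, ht⟩ := hX
  exact ⟨_, t, 0, rfl, by simpa [qsmul_zero_left] using ht.2⟩

variable [IsCancelAdd S]

/-- Adding a lower and an upper comparison of `X` with multiples of `E` eliminates `X` by
transitivity. Totality plays no role here. -/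
theorem sub_le_of_mem_upperCut {E : S} (hE : 0 ≤ E) (hE' : E ≠ 0) {X : S} {p q : ℚ≥0}
    (h : qsmul p E ≤ X + qsmul q E) {x : ℝ} (hx : x ∈ upperCut E X) : (p : ℝ) - q ≤ x := by
  obtain ⟨p', q', rfl, h'⟩ := hx
  have h1 : qsmul (p + q') E ≤ qsmul (p' + q) E := by
    rw [qsmul_add_left, qsmul_add_left]
    calc qsmul p E + qsmul q' E ≤ X + qsmul q E + qsmul q' E := add_mono₂ h le_rfl
      _ = X + qsmul q' E + qsmul q E := by abel
      _ ≤ _ := add_mono₂ h' le_rfl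
  have h2 : ((p + q' : ℚ≥0) : ℝ) ≤ ((p' + q : ℚ≥0) : ℝ) := by
    exact_mod_cast le_of_qsmul_le_qsmul hE hE' h1
  push_cast at h2
  linarith

/-- With `upperCut_nonempty`, this makes the `sInf` in `gauge` a true infimum rather than the
default value `0`. -/
theorem upperCut_bddBelow {E : S} (hE : 0 ≤ E) (hE' : E ≠ 0) {X : S}
    (hX : ∃ t : ℚ≥0, Within E t X 0) : BddBelow (upperCut E X) := by
  obtain ⟨t, ht⟩ := hX
  exact ⟨_, fun x hx => sub_le_of_mem_upperCut hE hE' (p := 0) (q := t)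
    (by simpa [qsmul_zero_left] using ht.1) hx⟩

theorem gauge_le {E : S} (hE : 0 ≤ E) (hE' : E ≠ 0) {X : S}
    (hX : ∃ t : ℚ≥0, Within E t X 0) {p q : ℚ≥0} (h : X + qsmul q E ≤ qsmul p E) :
    gauge E X ≤ (p : ℝ) - q :=
  csInf_le (upperCut_bddBelow hE hE' hX) ⟨p, q, rfl, h⟩

theorem le_gauge {E : S} (hE : 0 ≤ E) (hE' : E ≠ 0) {X : S}
    (hX : ∃ t : ℚ≥0, Within E t X 0) {p q : ℚ≥0} (h : qsmul p E ≤ X + qsmul q E) :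
    (p : ℝ) - q ≤ gauge E X :=
  le_csInf (upperCut_nonempty hX) fun _ hx => sub_le_of_mem_upperCut hE hE' h hx

theorem gauge_mono {E : S} (hE : 0 ≤ E) (hE' : E ≠ 0)
    (habs : ∀ X : S, ∃ t : ℚ≥0, Within E t X 0) {X Y : S} (h : X ≤ Y) :
    gauge E X ≤ gauge E Y := by
  apply csInf_le_csInf (upperCut_bddBelow hE hE' (habs X)) (upperCut_nonempty (habs Y))
  rintro _ ⟨p, q, rfl, h'⟩
  exact ⟨p, q, rfl, (add_mono₂ h le_rfl).trans h'⟩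

theorem gauge_self {E : S} (hE : 0 ≤ E) (hE' : E ≠ 0)
    (habs : ∀ X : S, ∃ t : ℚ≥0, Within E t X 0) : gauge E E = 1 := by
  have e : E + qsmul 0 E = qsmul 1 E := by rw [qsmul_zero_left, qsmul_one, add_zero]
  have h1 := gauge_le hE hE' (habs E) e.le
  have h2 := le_gauge hE hE' (habs E) e.ge
  simp only [NNRat.cast_one, NNRat.cast_zero, sub_zero] at h1 h2
  exact le_antisymm h1 h2

theorem gauge_add_le {E : S} (hE : 0 ≤ E) (hE' : E ≠ 0)
    (habs : ∀ X : S, ∃ t : ℚ≥0, Within E t X 0) (X Y : S) :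
    gauge E (X + Y) ≤ gauge E X + gauge E Y := by
  refine le_of_forall_pos_le_add fun ε hε => ?_
  obtain ⟨_, ⟨p, q, rfl, h⟩, hx⟩ := exists_lt_of_csInf_lt (upperCut_nonempty (habs X))
    (lt_add_of_pos_right (gauge E X) (half_pos hε))
  obtain ⟨_, ⟨p', q', rfl, h'⟩, hy⟩ := exists_lt_of_csInf_lt (upperCut_nonempty (habs Y))
    (lt_add_of_pos_right (gauge E Y) (half_pos hε))
  have h1 : X + Y + qsmul (q + q') E ≤ qsmul (p + p') E := by
    rw [qsmul_add_left, qsmul_add_left, add_add_add_comm]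
    exact add_mono₂ h h'
  have h2 := gauge_le hE hE' (habs _) h1
  push_cast at h2
  linarith

/-- Totality enters here: a rational strictly below the infimum fails the upper comparison, so the
reverse comparison holds. -/
theorem exists_le_of_lt_gauge (htot : ∀ X Y : S, X ≤ Y ∨ Y ≤ X) {E : S} (hE : 0 ≤ E)
    (hE' : E ≠ 0) {X : S} (hX : ∃ t : ℚ≥0, Within E t X 0) {x : ℝ} (hx : x < gauge E X) :
    ∃ p q : ℚ≥0, x < (p : ℝ) - q ∧ qsmul p E ≤ X + qsmul q E := by
  obtain ⟨r, h1, h2⟩ := exists_rat_btwn hx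
  -- Only non-negative rationals act, so `r` is split into its positive and negative parts.
  have hr : (r.toNNRat : ℝ) - (-r).toNNRat = r := by
    have : ((r.toNNRat : ℚ≥0) : ℚ) - ((-r).toNNRat : ℚ≥0) = r := by
      rw [Rat.toNNRat, Rat.toNNRat]
      change max r 0 - max (-r) 0 = r
      rcases le_total 0 r with h | h <;> simp [h]
    have h3 := congrArg (fun a : ℚ => (a : ℝ)) this
    simpa using h3
  refine ⟨r.toNNRat, (-r).toNNRat, by rwa [hr], ?_⟩
  refine (htot _ _).resolve_right fun h => ?_
  have h3 := gauge_le hE hE' hX h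
  rw [hr] at h3
  linarith

/-- Upper comparisons add up to subadditivity; the lower ones supplied by totality give the
converse. -/
theorem gauge_add (htot : ∀ X Y : S, X ≤ Y ∨ Y ≤ X) {E : S} (hE : 0 ≤ E) (hE' : E ≠ 0)
    (habs : ∀ X : S, ∃ t : ℚ≥0, Within E t X 0) (X Y : S) :
    gauge E (X + Y) = gauge E X + gauge E Y := by
  refine le_antisymm (gauge_add_le hE hE' habs X Y) (le_of_forall_pos_le_add fun ε hε => ?_)
  obtain ⟨p, q, hx, h⟩ := exists_le_of_lt_gauge htot hE hE' (habs X)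
    (sub_lt_self (gauge E X) (half_pos hε))
  obtain ⟨p', q', hy, h'⟩ := exists_le_of_lt_gauge htot hE hE' (habs Y)
    (sub_lt_self (gauge E Y) (half_pos hε))
  have h1 : qsmul (p + p') E ≤ X + Y + qsmul (q + q') E := by
    rw [qsmul_add_left, qsmul_add_left, add_add_add_comm]
    exact add_mono₂ h h'
  have h2 := le_gauge hE hE' (habs _) h1
  push_cast at h2
  linarith

/-- A totally ordered cancellative perfect semi-ring with absorbing element `E` has a morphism
to `(ℝ, max, +)` that takes the value `1` at `E`. -/
theorem exists_state (htot : ∀ X Y : S, X ≤ Y ∨ Y ≤ X) {E : S} (hE : 0 ≤ E) (hE' : E ≠ 0)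
    (habs : ∀ X : S, ∃ t : ℚ≥0, Within E t X 0) :
    ∃ f : S →+ ℝ, Monotone f ∧ (∀ X Y : S, f (X ⊔ Y) = max (f X) (f Y)) ∧ f E = 1 := by
  have hmono : Monotone (gauge E) := fun _ _ h => gauge_mono hE hE' habs h
  refine ⟨AddMonoidHom.mk' (gauge E) (gauge_add htot hE hE' habs), hmono, fun X Y => ?_,
    gauge_self hE hE' habs⟩
  change gauge E (X ⊔ Y) = max (gauge E X) (gauge E Y)
  rcases htot X Y with h | h
  · rw [sup_eq_right.2 h, max_eq_right (hmono h)]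
  · rw [sup_eq_left.2 h, max_eq_left (hmono h)]

end State

/-! ### Congruences on a semi-ring and on its quotients -/

namespace Congruence

section Constructions

variable {S : Type*} [CharOneSemiring S]

/-- `X ~ Y` when `|X - Y|` is at most a multiple of `B - A`, where `A ≤ B`. -/
def principal {A B : S} (h : A ≤ B) : Congruence S where
  r X Y := ∃ n : ℕ, X + n • A ≤ Y + n • B ∧ Y + n • A ≤ X + n • B
  iseqv :=
    { refl := fun _ => ⟨0, by simp, by simp⟩
      symm := fun ⟨n, h1, h2⟩ => ⟨n, h2, h1⟩
      trans := by
        have key : ∀ {X Y Z : S} {m n : ℕ}, X + m • A ≤ Y + m • B → Y + n • A ≤ Z + n • B →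
            X + (m + n) • A ≤ Z + (m + n) • B := fun {X Y Z m n} h1 h2 => by
          rw [add_nsmul, add_nsmul]
          calc X + (m • A + n • A) = X + m • A + n • A := by abel
            _ ≤ Y + m • B + n • A := add_mono₂ h1 le_rfl
            _ = Y + n • A + m • B := by abel
            _ ≤ Z + n • B + m • B := add_mono₂ h2 le_rfl
            _ = _ := by abel
        rintro X Y Z ⟨m, h1, h2⟩ ⟨n, h3, h4⟩
        exact ⟨m + n, key h1 h3, by rw [add_comm m n]; exact key h4 h2⟩ }
  add_right := by
    rintro X Y Z ⟨n, h1, h2⟩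
    refine ⟨n, ?_, ?_⟩ <;> rw [add_right_comm, add_right_comm _ Z]
    exacts [add_mono₂ h1 le_rfl, add_mono₂ h2 le_rfl]
  sup_right := by
    have key : ∀ {X Y : S} (Z : S) {n : ℕ}, X + n • A ≤ Y + n • B →
        X ⊔ Z + n • A ≤ Y ⊔ Z + n • B := fun {X Y} Z {n} h1 => by
      rw [add_comm, CharOneSemiring.add_sup_distrib, add_comm _ X, add_comm _ Z]
      -- The hypothesis `A ≤ B` is what controls the `Z` term.
      exact sup_le (h1.trans (add_mono₂ le_sup_left le_rfl))
        (add_mono₂ le_sup_right (nsmul_mono h n))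
    rintro X Y Z ⟨n, h1, h2⟩
    exact ⟨n, key Z h1, key Z h2⟩

theorem principal_cancellative [IsCancelAdd S] {A B : S} (h : A ≤ B) :
    (principal h).Cancellative := by
  rintro X Y Z ⟨n, h1, h2⟩
  rw [add_assoc, add_assoc] at h1 h2
  exact ⟨n, le_of_add_le h1, le_of_add_le h2⟩

theorem principal_self {A B : S} (h : A ≤ B) : (principal h).r A B :=
  ⟨1, by simpa using add_mono₂ h h, by simp [add_comm]⟩

/-- The kernel of a morphism to `(ℝ, max, +)`. -/
def kerReal (f : S →+ ℝ) (hf : ∀ X Y : S, f (X ⊔ Y) = max (f X) (f Y)) : Congruence S where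
  r X Y := f X = f Y
  iseqv := ⟨fun _ => rfl, Eq.symm, Eq.trans⟩
  add_right _ _ _ h := by rw [map_add, map_add, h]
  sup_right _ _ _ h := by rw [hf, hf, h]

end Constructions

variable {R : Type*} [CharOneSemiring R] {c : Congruence R}

/-- The pull-back to `R` of a congruence on a quotient of `R`. -/
def pullback (c : Congruence R) (d : Congruence c.Quot) : Congruence R where
  r X Y := d.r (c.proj X) (c.proj Y)
  iseqv := ⟨fun _ => d.iseqv.refl _, d.iseqv.symm, d.iseqv.trans⟩
  add_right _ _ Z h := d.add_right _ _ (c.proj Z) h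
  sup_right _ _ Z h := d.sup_right _ _ (c.proj Z) h

/-- The quotient by a maximal cancellative congruence is simple. -/
theorem IsMaximalCancellative.eq_or_trivial (hc : c.IsMaximalCancellative)
    {d : Congruence c.Quot} (hd : d.Cancellative) :
    (∀ x y : c.Quot, d.r x y → x = y) ∨ d.Trivial := by
  rcases hc.2.2 (pullback c d) (fun X Y Z h => hd (c.proj X) (c.proj Y) (c.proj Z) h)
    (fun X Y h => by
      change d.r (c.proj X) (c.proj Y)
      rw [(c.proj_eq_iff).2 h]) with h | h
  · left
    exact c.proj_surjective.forall₂.2 fun X Y hXY => (c.proj_eq_iff).2 ((h X Y).1 hXY)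
  · right
    exact c.proj_surjective.forall₂.2 h

theorem Cancellative.isCancelAdd (hc : c.Cancellative) : IsCancelAdd c.Quot := by
  have key : ∀ x y z : c.Quot, x + y = x + z → y = z :=
    c.proj_surjective.forall₃.2 fun X Y Z h => by
      rw [← proj_add, ← proj_add, proj_eq_iff] at h
      exact (c.proj_eq_iff).2 (hc X Y Z h)
  exact
    { add_left_cancel := fun x y z h => key x y z h
      add_right_cancel := fun x y z h => key x y z (by simpa [add_comm] using h) }

theorem proj_nsmul (c : Congruence R) (n : ℕ) (X : R) : c.proj (n • X) = n • c.proj X := by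
  induction n with
  | zero => simp [proj_zero]
  | succ n ih => rw [succ_nsmul, succ_nsmul, proj_add, ih]

instance (c : Congruence R) [IsPerfect R] : IsPerfect c.Quot where
  nsmul_surjective n hn := c.proj_surjective.forall.2 fun X => by
    obtain ⟨Y, hY⟩ := IsPerfect.nsmul_surjective (R := R) n hn X
    exact ⟨c.proj Y, by rw [← hY]; exact (c.proj_nsmul n Y).symm⟩

theorem proj_mono (c : Congruence R) {X Y : R} (h : X ≤ Y) : c.proj X ≤ c.proj Y := by
  rw [← sup_eq_right] at h ⊢
  exact congrArg c.proj h

theorem proj_qsmul [IsPerfect R] (c : Congruence R) [IsCancelAdd c.Quot] (t : ℚ≥0) (X : R) :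
    c.proj (qsmul t X) = qsmul t (c.proj X) := by
  refine eq_qsmul t.den_pos (den_mul t) ?_
  rw [← proj_nsmul, den_nsmul_qsmul, proj_nsmul]

theorem within_proj [IsPerfect R] (c : Congruence R) [IsCancelAdd c.Quot] {E X Y : R}
    {t : ℚ≥0} (h : Within E t X Y) : Within (c.proj E) t (c.proj X) (c.proj Y) := by
  unfold Within
  rw [← proj_qsmul, ← proj_add, ← proj_add]
  exact ⟨c.proj_mono h.1, c.proj_mono h.2⟩

end Congruence

/-! ### Simplicity implies total order -/

section Total

variable {S : Type*} [CharOneSemiring S] [IsCancelAdd S]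

/-- Expand `2n(A ⊔ B)` as a join of terms `aA + bB` with `a + b = 2n`. In each term `a ≥ n` or `b ≥
n`, so one of the two hypotheses absorbs `E`; cancelling `2n(A ⊔ B)` leaves `E ≤ 0`. -/
theorem nonpos_of_add_nsmul_le {E A B : S} {n : ℕ} (hA : E + n • A ≤ n • (A ⊔ B))
    (hB : E + n • B ≤ n • (A ⊔ B)) : E ≤ 0 := by
  have hm : ∀ p q : ℕ, p • A + q • B ≤ (p + q) • (A ⊔ B) := fun p q => by
    rw [add_nsmul]
    exact add_mono₂ (nsmul_mono le_sup_left _) (nsmul_mono le_sup_right _)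
  have key : E + (n + n) • (A ⊔ B) ≤ (n + n) • (A ⊔ B) := by
    refine nsmul_sup_le A B _ _ E fun a b hab => ?_
    rcases le_total n a with h | h
    · obtain ⟨k, rfl⟩ := Nat.exists_eq_add_of_le h
      calc E + ((n + k) • A + b • B) = (E + n • A) + (k • A + b • B) := by
            rw [add_nsmul]; abel
        _ ≤ n • (A ⊔ B) + (k + b) • (A ⊔ B) := add_mono₂ hA (hm _ _)
        _ = (n + n) • (A ⊔ B) := by rw [← add_nsmul]; congr 1; omega
    · obtain ⟨k, rfl⟩ : ∃ k, b = n + k := ⟨b - n, by omega⟩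
      calc E + (a • A + (n + k) • B) = (E + n • B) + (a • A + k • B) := by
            rw [add_nsmul]; abel
        _ ≤ n • (A ⊔ B) + (a + k) • (A ⊔ B) := add_mono₂ hB (hm _ _)
        _ = (n + n) • (A ⊔ B) := by rw [← add_nsmul]; congr 1; omega
  refine le_of_add_le (Z := (n + n) • (A ⊔ B)) ?_
  rwa [add_zero, add_comm]

/-- A simple cancellative semi-ring is totally ordered. -/
theorem le_total_of_simple
    (hS : ∀ d : Congruence S, d.Cancellative → (∀ X Y : S, d.r X Y → X = Y) ∨ d.Trivial)
    {E : S} (hE : 0 ≤ E) (hE' : E ≠ 0) (A B : S) : A ≤ B ∨ B ≤ A := by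
  by_contra! hAB
  have key : ∀ C : S, C ≤ A ⊔ B → C ≠ A ⊔ B →
      ∃ n : ℕ, E + n • C ≤ n • (A ⊔ B) := by
    intro C h hne
    rcases hS _ (Congruence.principal_cancellative h) with h1 | h1
    · exact absurd (h1 _ _ (Congruence.principal_self h)) hne
    -- The congruence generated by `C ~ A ⊔ B` is trivial, hence identifies `E` with `0`.
    · obtain ⟨n, h2, -⟩ := h1 E 0
      exact ⟨n, by simpa using h2⟩
  -- The two exponents may differ; both are raised to `m + n`.
  have lift : ∀ {C : S} {m n : ℕ}, C ≤ A ⊔ B → E + m • C ≤ m • (A ⊔ B) →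
      E + (m + n) • C ≤ (m + n) • (A ⊔ B) := fun {C m n} hC h => by
    rw [add_nsmul, add_nsmul, ← add_assoc]
    exact add_mono₂ h (nsmul_mono hC n)
  obtain ⟨m, hm⟩ := key A le_sup_left fun h => hAB.2 (by rw [h]; exact le_sup_right)
  obtain ⟨n, hn⟩ := key B le_sup_right fun h => hAB.1 (by rw [h]; exact le_sup_left)
  refine hE' (le_antisymm (nonpos_of_add_nsmul_le (lift (n := n) le_sup_left hm) ?_) hE)
  rw [add_comm m n]
  exact lift le_sup_right hn

end Total

/-! ### Embedding the maximal quotient into the reals -/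

section Quotient

variable {R : Type*} [CharOneSemiring R] [IsCancelAdd R] [IsPerfect R] {E : R}

/-- Positivity of `E` is forced by absorption: `-tE ≤ X ≤ tE` gives `0 ≤ 2tE`, and `X ≠ 0` excludes
`t = 0`. -/
theorem IsBanach.nonneg (hE : IsBanach E) (hR : ∃ X : R, X ≠ 0) : 0 ≤ E := by
  obtain ⟨X, hX⟩ := hR
  obtain ⟨t, h1, h2⟩ := hE.absorbing X
  rw [zero_add] at h2
  have ht : t ≠ 0 := by
    rintro rfl
    rw [qsmul_zero_left] at h1 h2
    exact hX (le_antisymm h2 (by simpa using h1))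
  have h3 : 0 ≤ 2 • qsmul t E := by
    rw [two_nsmul]
    exact h1.trans (add_mono₂ h2 le_rfl)
  have h4 : 0 ≤ qsmul t E := le_of_nsmul_le two_pos (by rwa [smul_zero])
  have h5 := nsmul_mono h4 t.den
  rw [smul_zero, den_nsmul_qsmul] at h5
  have ht' : 0 < t.num := Nat.pos_of_ne_zero (by simpa using ht)
  exact le_of_nsmul_le ht' (by rwa [smul_zero])

/-- Morphisms to `(ℝ, max, +)` normalized at `E` are contractions. -/
theorem IsBanach.abs_sub_le_rdist (hE : IsBanach E) {f : R →+ ℝ} (hf : Monotone f)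
    (hfE : f E = 1) (X Y : R) : |f X - f Y| ≤ rdist E X Y := by
  refine le_of_forall_pos_le_add fun ε hε => ?_
  obtain ⟨t, ht, h1, h2⟩ := hE.exists_within_lt (lt_add_of_pos_right (rdist E X Y) hε)
  have h3 := hf h1
  have h4 := hf h2
  rw [map_add, map_qsmul_real, hfE, mul_one] at h3 h4
  rw [abs_le]
  constructor <;> linarith

/-- Along rationals tending to `lam`, the contraction property and rational homogeneity compute the
same limit. -/
theorem IsBanach.map_realMul (hE : IsBanach E) {f : R →+ ℝ} (hf : Monotone f)
    (hfE : f E = 1) (lam : ℝ≥0) (X : R) : f (realMul hE lam X) = lam * f X := by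
  obtain ⟨t, ht⟩ := exists_tendsto_nnrat lam
  have h1 := isRealMultiple_realMul hE lam X t ht
  have h2 : Tendsto (fun n => f (qsmul (t n) X)) atTop (𝓝 (f (realMul hE lam X))) := by
    rw [tendsto_iff_dist_tendsto_zero]
    exact squeeze_zero (fun _ => dist_nonneg)
      (fun n => hE.abs_sub_le_rdist hf hfE _ _) h1
  have h3 : Tendsto (fun n => f (qsmul (t n) X)) atTop (𝓝 (lam * f X)) := by
    simp_rw [map_qsmul_real]
    exact ht.mul_const _
  exact tendsto_nhds_unique h2 h3

/-- The quotient by a maximal cancellative congruence embeds into `(ℝ, max, +)`. -/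
theorem Congruence.IsMaximalCancellative.exists_embedding (hE : IsBanach E) {c : Congruence R}
    (hc : c.IsMaximalCancellative) :
    (∀ x y : c.Quot, x ≤ y ∨ y ≤ x) ∧ ∃ F : c.Quot →+ ℝ, Monotone F ∧
      (∀ x y : c.Quot, F (x ⊔ y) = max (F x) (F y)) ∧ F (c.proj E) = 1 ∧
      Function.Injective F := by
  have := hc.1.isCancelAdd
  have hR : ∃ X : R, X ≠ 0 := by
    by_contra! h
    exact hc.2.1 fun X Y => by rw [h X, h Y]
  have habs : ∀ x : c.Quot, ∃ t : ℚ≥0, Within (c.proj E) t x 0 :=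
    c.proj_surjective.forall.2 fun X => (hE.absorbing X).imp fun _ h => c.within_proj h
  have hE0 : 0 ≤ c.proj E := c.proj_mono (hE.nonneg hR)
  have hE1 : c.proj E ≠ 0 := by
    intro h0
    -- If `E` became `0`, absorption would squeeze every class to `0`.
    have hz : ∀ x : c.Quot, x = 0 := fun x => by
      obtain ⟨t, h1, h2⟩ := habs x
      rw [h0, qsmul_zero_right, add_zero] at h1 h2
      exact le_antisymm h2 h1
    exact hc.2.1 fun X Y => (c.proj_eq_iff).1 ((hz _).trans (hz _).symm)
  have htot := le_total_of_simple (fun d hd => hc.eq_or_trivial hd) hE0 hE1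
  obtain ⟨F, hmono, hsup, hFE⟩ := exists_state htot hE0 hE1 habs
  refine ⟨htot, F, hmono, hsup, hFE, fun x y hxy => ?_⟩
  have hker : (Congruence.kerReal F hsup).Cancellative := fun X Y Z h => by
    change F (X + Y) = F (X + Z) at h
    rw [map_add, map_add] at h
    exact add_left_cancel h
  rcases hc.eq_or_trivial hker with h | h
  · exact h x y hxy
  · have h1 : F (c.proj E) = F 0 := h _ _
    rw [hFE, map_zero] at h1
    exact absurd h1 one_ne_zero

end Quotient

end CharOne

/-! ### The two cases, according to the image of `F` -/

theorem theorem6p2 {R : Type*} [CharOne.CharOneSemiring R] [IsCancelAdd R] [CharOne.IsPerfect R]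
    {E : R} (hE : CharOne.IsBanach E)
    (c : CharOne.Congruence R) (hc : c.IsMaximalCancellative) :
    -- the action of `ℝ⁺` descends to the quotient, by `lam (π₀ X) = π₀ (lam X)`
    (∀ (lam : NNReal) (X Y : R), c.proj X = c.proj Y →
      c.proj (CharOne.realMul hE lam X) = c.proj (CharOne.realMul hE lam Y)) ∧
    -- first case: all elements of the quotient are `≥ 0`
    ((∀ x : c.Quot, 0 ≤ x) →
      (∀ x : c.Quot, ∃ lam : NNReal, x = c.proj (CharOne.realMul hE lam E)) ∧
      ∃ e : CharOne.SemiringIso c.Quot NNReal,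
        ∀ lam : NNReal, e.toEquiv (c.proj (CharOne.realMul hE lam E)) = lam) ∧
    -- second case: some element of the quotient is not `≥ 0`
    ((∃ x : c.Quot, ¬ 0 ≤ x) → Nonempty (CharOne.SemiringIso c.Quot ℝ)) := by
  obtain ⟨htot, F, hmono, hsup, hFE, hinj⟩ := hc.exists_embedding hE
  have hmul : ∀ (lam : NNReal) (X : R),
      F (c.proj (CharOne.realMul hE lam X)) = lam * F (c.proj X) := fun lam X =>
    hE.map_realMul (f := F.comp ⟨⟨c.proj, c.proj_zero⟩, c.proj_add⟩)
      (fun _ _ h => hmono (c.proj_mono h)) hFE lam X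
  have hmulE : ∀ lam : NNReal, F (c.proj (CharOne.realMul hE lam E)) = lam := fun lam => by
    rw [hmul, hFE, mul_one]
  refine ⟨fun lam X Y h => hinj (by rw [hmul, hmul, h]), fun hpos => ?_, ?_⟩
  · have hF : ∀ x, 0 ≤ F x := fun x => by simpa using hmono (hpos x)
    have hbij : Function.Bijective (fun x => (⟨F x, hF x⟩ : NNReal)) :=
      ⟨fun x y h => hinj (congrArg NNReal.toReal h),
        fun lam => ⟨c.proj (CharOne.realMul hE lam E), NNReal.eq (hmulE lam)⟩⟩
    refine ⟨fun x => ⟨(⟨F x, hF x⟩ : NNReal), hinj (hmulE ⟨F x, hF x⟩).symm⟩,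
      ⟨Equiv.ofBijective _ hbij, fun x y => ?_, fun x y => ?_⟩, fun lam => NNReal.eq (hmulE lam)⟩
    · exact NNReal.eq ((hsup x y).trans (NNReal.coe_max ⟨F x, hF x⟩ ⟨F y, hF y⟩).symm)
    · exact NNReal.eq (map_add F x y)
  · rintro ⟨x, hx⟩
    -- Totality gives `x ≤ 0`, and injectivity of `F` rules out `F x = 0`.
    have hneg : F x < 0 := by
      refine lt_of_le_of_ne ?_ fun h => hx (hinj (by rw [h, map_zero])).ge
      simpa using hmono ((htot 0 x).resolve_left hx)
    have hsurj : Function.Surjective F := fun y => by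
      -- Enough copies of `x` go below `y`; a non-negative real multiple of `E` fills the gap.
      obtain ⟨n, hn⟩ := exists_nat_gt (y / F x)
      have hn' : n * F x ≤ y := ((div_lt_iff_of_neg hneg).1 hn).le
      refine ⟨n • x + c.proj (CharOne.realMul hE (y - n * F x).toNNReal E), ?_⟩
      rw [map_add, map_nsmul, hmulE, Real.coe_toNNReal _ (sub_nonneg.2 hn'), nsmul_eq_mul]
      exact add_sub_cancel _ _
    exact ⟨⟨Equiv.ofBijective F ⟨hinj, hsurj⟩, hsup, map_add F⟩⟩
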